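/- Let $X$ be a complete locally compact length space, i.e. a complete, locally compact metric space in which the distance between two points is the infimum of the lengths of the curves joining them. Let $x\in X$ and $R\in\mathbb R$. For a collection $\mathcal U$ of open sets covering $X$, let $\pi_1(X,\mathcal U,x)\subset\pi_1(X,x)$ be the (normal) subgroup generated by the classes of loops $\alpha\cdot\beta\cdot\alpha^{-1}$, where $\beta$ is a closed path lying in some element of $\mathcal U$ and $\alpha$ is a path from $x$ to $\beta(0)$. The Spanier cover of $X$ for $\mathcal U$ is the covering space of $X$ with covering group $\pi_1(X,\mathcal U,x)$: its points are the classes of paths $\gamma$ starting at $x$, where $\gamma\sim\gamma'$ if they have the same end point and $[\gamma\cdot\gamma'^{-1}]\in\pi_1(X,\mathcal U,x)$; its topology is generated by the sets $\{[\gamma\cdot\eta] : \eta \text{ a path in } V \text{ starting at } \gamma(1)\}$, where $V$ is open and contains $\gamma(1)$; and its projection to $X$ is $[\gamma]\mapsto\gamma(1)$. For $\delta>0$ the $R$ cut-off $\delta$ cover $\tilde X^{\delta,R}_{cut}$ based at $x$ is the Spanier cover for the collection consisting of all open balls $B_q(\delta)$, $q\in X$, together with $X\setminus\bar B_x(R)$.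 The $R$ cut-off covering spectrum $CovSpec^R_{cut}(X,x)$ is the set of all $\delta>0$ such that, for every $\delta_1>\delta$, the covers $\tilde X^{\delta_1,R}_{cut}$ and $\tilde X^{\delta,R}_{cut}$ are not isomorphic as covering spaces of $X$ (there is no homeomorphism between them that commutes with the projections to $X$). A closed geodesic is a map from a circle of some circumference $L>0$ to $X$ which is locally minimizing and parametrized by arc length, i.e. every point of the circle has a neighbourhood on which the map preserves distances. The length spectrum $L(X)$ is the set of lengths of closed geodesics in $X$. Theorem. If $\delta\in CovSpec^R_{cut}(X,x)$, then $2\delta\in L(X)$. That is, $CovSpec^R_{cut}(X,x)\subset\tfrac12 L(X)$. -/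

import Mathlib

open Set Topology unitInterval

namespace CutoffSpectrum

/-! ### Length spaces, closed geodesics, length spectrum -/

/-- The length of a path (the supremum of the lengths of inscribed polygons). -/
noncomputable def pathLength {X : Type*} [MetricSpace X] {a b : X} (γ : Path a b) : ENNReal :=
  eVariationOn (fun t : I => γ t) Set.univ

/-- A length space: the distance between two points is the infimum of the lengths of the curves
joining them. -/
def IsLengthSpace (X : Type*) [MetricSpace X] : Prop :=
  ∀ a b : X, edist a b = ⨅ γ : Path a b, pathLength γ

/-- A closed geodesic, parametrized by arc length on a circle of circumference `L`: a closed curve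
which is locally minimizing, i.e. every point of the circle has a neighbourhood on which `γ`
preserves distances. -/
def IsClosedGeodesic {X : Type*} [MetricSpace X] {L : ℝ} (γ : AddCircle L → X) : Prop :=
  ∀ t : AddCircle L, ∃ U ∈ 𝓝 t, ∀ s ∈ U, ∀ s' ∈ U, dist (γ s) (γ s') = dist s s'

/-- The length of a closed curve on a circle of circumference `L`. -/
noncomputable def closedCurveLength {X : Type*} [MetricSpace X] {L : ℝ} (γ : AddCircle L → X) :
    ENNReal :=
  eVariationOn (fun t : ℝ => γ (t : AddCircle L)) (Set.Icc 0 L)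

/-- The length spectrum: the set of lengths of closed geodesics. -/
def lengthSpectrum (X : Type*) [MetricSpace X] : Set ℝ :=
  {l | ∃ L : ℝ, 0 < L ∧ ∃ γ : AddCircle L → X,
    IsClosedGeodesic γ ∧ closedCurveLength γ = ENNReal.ofReal l}

/-! ### Covering spaces attached to subgroups of the fundamental group -/

section Cover

variable {X : Type*} [TopologicalSpace X] {p : X}

/-- Two paths from `p` to `y` are identified when the loop "first path followed by the inverse of
the second" has its class in `H`. -/
def coverSetoid (H : Subgroup (FundamentalGroup X p)) (y : X) : Setoid (Path p y) where
  r a b := FundamentalGroup.fromPath (Path.Homotopic.Quotient.mk (a.trans b.symm)) ∈ H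
  iseqv := by
    refine ⟨fun a => ?_, fun {a b} h => ?_, fun {a b c} h₁ h₂ => ?_⟩
    · have : (FundamentalGroup.fromPath (Path.Homotopic.Quotient.mk (a.trans a.symm)) :
          FundamentalGroup X p) = 1 :=
        Path.Homotopic.Quotient.eq.2 ⟨(Path.Homotopy.reflTransSymm a).symm⟩
      rw [this]
      exact H.one_mem
    · have h' := H.inv_mem h
      have : (FundamentalGroup.fromPath (Path.Homotopic.Quotient.mk (a.trans b.symm)) :
          FundamentalGroup X p)⁻¹
          = FundamentalGroup.fromPath (Path.Homotopic.Quotient.mk (b.trans a.symm)) := by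
        change Path.Homotopic.Quotient.mk ((a.trans b.symm).symm) = _
        simp [Path.trans_symm]
      rwa [this] at h'
    · have h' := H.mul_mem h₂ h₁
      have : (FundamentalGroup.fromPath (Path.Homotopic.Quotient.mk (b.trans c.symm)) :
          FundamentalGroup X p)
          * FundamentalGroup.fromPath (Path.Homotopic.Quotient.mk (a.trans b.symm))
          = FundamentalGroup.fromPath (Path.Homotopic.Quotient.mk (a.trans c.symm)) := by
        change Path.Homotopic.Quotient.mk ((a.trans b.symm).trans (b.trans c.symm)) = _
        refine Path.Homotopic.Quotient.eq.2 ?_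
        refine ⟨(Path.Homotopy.transAssoc a b.symm (b.trans c.symm)).trans
          ((Path.Homotopy.refl a).hcomp ?_)⟩
        exact (Path.Homotopy.transAssoc b.symm b c.symm).symm.trans
          (((Path.Homotopy.reflSymmTrans b).symm.hcomp (Path.Homotopy.refl c.symm)).trans
            (Path.Homotopy.reflTrans c.symm))
      rwa [this] at h'

/-- The points of the covering space of `X` with covering group `H`: classes of paths issuing
from `p`, modulo `H`. -/
structure Cover (H : Subgroup (FundamentalGroup X p)) where
  /-- the projection to `X`: the end point of the path -/
  proj : X
  /-- the class of the path -/
  cls : Quotient (coverSetoid H proj)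

namespace Cover

variable {H : Subgroup (FundamentalGroup X p)}

/-- The point of the covering space represented by a path from `p`. -/
def ofPath (H : Subgroup (FundamentalGroup X p)) {y : X} (γ : Path p y) : Cover H :=
  ⟨y, Quotient.mk (coverSetoid H y) γ⟩

/-- The basic neighbourhood of the class of `γ`: all classes of `γ` followed by a path in `V`. -/
def basicNhd (H : Subgroup (FundamentalGroup X p)) {y : X} (γ : Path p y) (V : Set X) :
    Set (Cover H) :=
  {e | ∃ (z : X) (η : Path y z), Set.range η ⊆ V ∧ e = ofPath H (γ.trans η)}

instance : TopologicalSpace (Cover H) :=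
  TopologicalSpace.generateFrom
    {A | ∃ (y : X) (γ : Path p y) (V : Set X), IsOpen V ∧ y ∈ V ∧ A = basicNhd H γ V}

/-- Equality of covering spaces of `X`: there is a homeomorphism commuting with the projections. -/
def Equivalent (H K : Subgroup (FundamentalGroup X p)) : Prop :=
  ∃ h : Cover H ≃ₜ Cover K, ∀ e : Cover H, (h e).proj = e.proj

end Cover

/-- The Spanier group `π₁(X, 𝒰, p)`, generated by the classes of the loops `α · β · α⁻¹`, with `β` a
loop contained in some element of `𝒰` and `α` a path from `p` to the base point of `β`. -/
noncomputable def spanierGroup (𝒰 : Set (Set X)) (p : X) : Subgroup (FundamentalGroup X p) :=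
  Subgroup.closure
    {g | ∃ U ∈ 𝒰, ∃ (y : X) (α : Path p y) (β : Path y y), Set.range β ⊆ U ∧
      g = FundamentalGroup.fromPath (Path.Homotopic.Quotient.mk ((α.trans β).trans α.symm))}

end Cover

/-! ### The `R` cut-off covering spectrum -/

/-- The open balls of radius `δ`, together with the complement of the closed ball of radius `R`
about `x`. -/
def cutoffSets {X : Type*} [MetricSpace X] (x : X) (R δ : ℝ) : Set (Set X) :=
  {U | ∃ q : X, U = Metric.ball q δ} ∪ {(Metric.closedBall x R)ᶜ}

/-- The covering group of the `R` cut-off `δ` cover based at `x`. -/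
noncomputable def cutoffGroup {X : Type*} [MetricSpace X] (x : X) (R δ : ℝ) :
    Subgroup (FundamentalGroup X x) :=
  spanierGroup (cutoffSets x R δ) x

/-- The `R` cut-off covering spectrum of `(X, x)`: all `δ > 0` such that for every `δ₁ > δ` the
`R` cut-off `δ₁` cover `Cover (cutoffGroup x R δ₁)` and the `R` cut-off `δ` cover
`Cover (cutoffGroup x R δ)` are different covering spaces of `X`. -/
def cutoffCovSpec {X : Type*} [MetricSpace X] (x : X) (R : ℝ) : Set ℝ :=
  {δ | 0 < δ ∧ ∀ δ₁ : ℝ, δ < δ₁ →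
    ¬ Cover.Equivalent (cutoffGroup x R δ₁) (cutoffGroup x R δ)}

end CutoffSpectrum

/-!
Write `G δ` for the covering group of the cut-off `δ` cover. If `δ` lies in the cut-off covering
spectrum, then `G δ₁ ≠ G δ` for every `δ₁ > δ`, since equal subgroups give equal covers. Hence some
loop in a ball `B_q(δ₁)` is nontrivial modulo `G δ`. The centre `q` stays within distance `R + δ₁` of
the base point, because a ball farther away lies in the complement of the closed ball of radius `R`,
whose loops belong to `G δ` (`exists_loop_of_mem_cutoffCovSpec`).

Joining `q` by minimal geodesics to the points of the loop cuts the loop into arbitrarily thin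
triangles, one of which has to be nontrivial (`exists_frequently_hol_triangle_ne`). The space is
proper (`IsLengthSpace.properSpace`), so these triangles converge as `δ₁ → δ` to a bigon: two minimal
geodesics of length at most `δ` with common end points `q` and `a`. Uniformly close paths agree
modulo `G δ`, so the bigon is still nontrivial (`TrivialOnBalls.exists_hol_ne`).

A loop of length less than `2 δ` lies in a ball of radius `δ` about each of its points, hence is
trivial modulo `G δ`. So the sides of the bigon have length exactly `δ`, and no chord between the two
sides is shorter than both arcs that it cuts off, since it would divide the bigon into two loops of
length less than `2 δ` (`TrivialOnBalls.dist_bigon`). This says that the bigon is an isometric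
embedding of the circle of circumference `2 δ`, in particular a closed geodesic of length `2 δ`.

"Modulo `G δ`" is made precise by the quotient of the fundamental groupoid by the congruence
`holRel` attached to `G δ`: `hol H γ` is the class of the path `γ` in the quotient groupoid, and a
loop is trivial there exactly when all its transports to the base point lie in `H` (`hol_eq_id_iff`).
-/

namespace CutoffSpectrum

/-! ### Metric geometry of length spaces -/

section LengthSpace

variable {X : Type*} [MetricSpace X]

theorem edist_add_edist_add_edist_le_pathLength {a b : X} (γ : Path a b) {s t : I} (hst : s ≤ t) :
    edist a (γ s) + edist (γ s) (γ t) + edist (γ t) b ≤ pathLength γ := by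
  have h1 := eVariationOn.Icc_add_Icc (fun t : I => γ t) (s := univ) (a := 0) (b := s) (c := t)
    bot_le hst (mem_univ _)
  have h2 := eVariationOn.Icc_add_Icc (fun t : I => γ t) (s := univ) (a := 0) (b := t) (c := 1)
    bot_le le_top (mem_univ _)
  have key : ∀ u v : I, u ≤ v → edist (γ u) (γ v) ≤
      eVariationOn (fun t : I => γ t) (univ ∩ Icc u v) := fun u v huv =>
    eVariationOn.edist_le (fun t : I => γ t) ⟨mem_univ _, left_mem_Icc.2 huv⟩
      ⟨mem_univ _, right_mem_Icc.2 huv⟩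
  calc edist a (γ s) + edist (γ s) (γ t) + edist (γ t) b
      = edist (γ 0) (γ s) + edist (γ s) (γ t) + edist (γ t) (γ 1) := by simp
    _ ≤ eVariationOn (fun t : I => γ t) (univ ∩ Icc 0 1) := by
        rw [← h2, ← h1]
        exact add_le_add (add_le_add (key _ _ bot_le) (key _ _ hst)) (key _ _ le_top)
    _ ≤ pathLength γ := eVariationOn.mono _ (subset_univ _)

/-- Any two points at distance less than `r` in a length space are joined by a path whose
inscribed polygons with two interior vertices have length less than `r`. -/
theorem IsLengthSpace.exists_path (hX : IsLengthSpace X) {a b : X} {r : ℝ} (h : dist a b < r) :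
    ∃ γ : Path a b, ∀ s t : I, s ≤ t → dist a (γ s) + dist (γ s) (γ t) + dist (γ t) b < r := by
  have hr : 0 < r := dist_nonneg.trans_lt h
  have h' : edist a b < ENNReal.ofReal r := by
    rw [edist_dist]; exact (ENNReal.ofReal_lt_ofReal_iff hr).2 h
  rw [hX a b, iInf_lt_iff] at h'
  obtain ⟨γ, hγ⟩ := h'
  refine ⟨γ, fun s t hst => ?_⟩
  have := (edist_add_edist_add_edist_le_pathLength γ hst).trans_lt hγ
  rw [edist_dist, edist_dist, edist_dist, ← ENNReal.ofReal_add (by positivity) (by positivity),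
    ← ENNReal.ofReal_add (by positivity) (by positivity)] at this
  exact (ENNReal.ofReal_lt_ofReal_iff hr).1 this

theorem IsLengthSpace.exists_path_add_lt (hX : IsLengthSpace X) {a b : X} {r : ℝ}
    (h : dist a b < r) : ∃ γ : Path a b, ∀ s : I, dist a (γ s) + dist (γ s) b < r := by
  obtain ⟨γ, hγ⟩ := hX.exists_path h
  exact ⟨γ, fun s => by simpa using hγ s s le_rfl⟩

theorem IsLengthSpace.exists_path_subset_ball (hX : IsLengthSpace X) {a b : X} {r : ℝ}
    (h : dist a b < r) : ∃ γ : Path a b, range γ ⊆ Metric.ball a r := by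
  obtain ⟨γ, hγ⟩ := hX.exists_path_add_lt h
  refine ⟨γ, ?_⟩
  rintro _ ⟨s, rfl⟩
  have := hγ s
  rw [Metric.mem_ball, dist_comm]
  linarith [dist_nonneg (x := γ s) (y := b)]

/-- Two open balls of a length space whose radii add up to more than the distance of the centres
meet. -/
theorem IsLengthSpace.exists_dist_lt_dist_lt (hX : IsLengthSpace X) {a b : X} {s t : ℝ}
    (hs : 0 < s) (ht : 0 < t) (h : dist a b < s + t) : ∃ c, dist a c < s ∧ dist c b < t := by
  obtain ⟨γ, hγ⟩ := hX.exists_path_add_lt h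
  have := isPreconnected_univ (α := I) {u | dist a (γ u) < s} {u | dist (γ u) b < t}
    (isOpen_lt (by fun_prop) (by fun_prop)) (isOpen_lt (by fun_prop) (by fun_prop))
    (fun u _ => by
      by_contra hu
      simp only [mem_union, mem_ofPred_eq, not_or, not_lt] at hu
      linarith [hγ u, hu.1, hu.2])
    ⟨0, by simpa using hs⟩ ⟨1, by simpa using ht⟩
  obtain ⟨u, -, h1, h2⟩ := this
  exact ⟨γ u, h1, h2⟩

/-- The Hopf–Rinow theorem of Cohn-Vossen: a complete locally compact length space is proper. The
radii of the compact closed balls about a point form a set which is open by local compactness, and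
closed since a ball whose smaller concentric balls are compact is totally bounded. -/
theorem IsLengthSpace.properSpace [CompleteSpace X] [LocallyCompactSpace X]
    (hX : IsLengthSpace X) : ProperSpace X := by
  refine ⟨fun x => ?_⟩
  by_contra! hbad
  obtain ⟨R, hR⟩ := hbad
  have hmono : ∀ r r', r ≤ r' → IsCompact (Metric.closedBall x r') →
      IsCompact (Metric.closedBall x r) := fun r r' h hc =>
    hc.of_isClosed_subset Metric.isClosed_closedBall (Metric.closedBall_subset_closedBall h)
  set S : Set ℝ := {r | IsCompact (Metric.closedBall x r)} with hS
  have hne : S.Nonempty := ⟨0, by simp [hS]⟩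
  have hbdd : BddAbove S := ⟨R, fun r hr => by
    by_contra! hlt
    exact hR (hmono _ _ hlt.le hr)⟩
  set ρ := sSup S with hρ
  have hρ0 : 0 ≤ ρ := le_csSup hbdd (by simp [hS])
  have hlow : ∀ r < ρ, IsCompact (Metric.closedBall x r) := fun r hr => by
    obtain ⟨r', hr', hlt⟩ := exists_lt_of_lt_csSup hne hr
    exact hmono _ _ hlt.le hr'
  have hcpt : IsCompact (Metric.closedBall x ρ) := by
    rw [isCompact_iff_totallyBounded_isComplete]
    refine ⟨Metric.totallyBounded_iff.2 fun ε hε => ?_, Metric.isClosed_closedBall.isComplete⟩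
    obtain ⟨T, hT, hcov⟩ := Metric.totallyBounded_iff.1
      (hlow (ρ - ε / 4) (by linarith)).totallyBounded (ε / 2) (by positivity)
    rcases lt_or_ge (ρ - ε / 4) (ε / 4) with hsmall | hbig
    · refine ⟨{x}, finite_singleton x, fun y hy => ?_⟩
      simp only [mem_singleton_iff, iUnion_iUnion_eq_left, Metric.mem_ball]
      rw [Metric.mem_closedBall] at hy
      linarith
    · refine ⟨T, hT, fun y hy => ?_⟩
      rw [Metric.mem_closedBall, dist_comm] at hy
      obtain ⟨c, hc1, hc2⟩ := hX.exists_dist_lt_dist_lt (a := x) (b := y) (s := ρ - ε / 4)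
        (t := ε / 2) (by linarith) (by linarith) (by linarith)
      have hc : c ∈ Metric.closedBall x (ρ - ε / 4) := by
        rw [Metric.mem_closedBall, dist_comm]; exact hc1.le
      obtain ⟨z, hz, hcz⟩ := mem_iUnion₂.1 (hcov hc)
      refine mem_iUnion₂.2 ⟨z, hz, ?_⟩
      rw [Metric.mem_ball] at hcz ⊢
      linarith [dist_triangle y c z, dist_comm y c]
  obtain ⟨ε, hε, hthick⟩ := hcpt.exists_isCompact_cthickening
  have : IsCompact (Metric.closedBall x (ρ + ε / 2)) := by
    refine hthick.of_isClosed_subset Metric.isClosed_closedBall fun y hy => ?_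
    rw [Metric.mem_closedBall, dist_comm] at hy
    rcases eq_or_lt_of_le hρ0 with h0 | h0
    · refine Metric.mem_cthickening_of_dist_le y x ε _ (by simp [← h0]) ?_
      rw [dist_comm]; linarith
    · obtain ⟨c, hc1, hc2⟩ := hX.exists_dist_lt_dist_lt (a := x) (b := y) (s := ρ)
        (t := ε) h0 hε (by linarith)
      refine Metric.mem_cthickening_of_dist_le y c ε _ ?_ ?_
      · rw [Metric.mem_closedBall, dist_comm]; exact hc1.le
      · rw [dist_comm]; exact hc2.le
  have := le_csSup hbdd this
  linarith

/-- A path which is a minimal geodesic parametrized proportionally to arc length. -/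
def IsMinimal {a b : X} (γ : Path a b) : Prop :=
  ∀ s t : I, dist (γ s) (γ t) = dist a b * |(s : ℝ) - t|

theorem IsMinimal.dist_left {a b : X} {γ : Path a b} (h : IsMinimal γ) (t : I) :
    dist a (γ t) = dist a b * t := by
  have := h 0 t
  simpa [abs_of_nonneg t.2.1] using this

theorem IsMinimal.dist_right {a b : X} {γ : Path a b} (h : IsMinimal γ) (t : I) :
    dist (γ t) b = dist a b * (1 - t) := by
  have := h t 1
  rw [abs_sub_comm] at this
  simpa [abs_of_nonneg (sub_nonneg.2 t.2.2)] using this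

/-- In a compact set, every sequence of functions has a pointwise limit along an ultrafilter. -/
theorem exists_tendsto_of_mem_compact {ι T : Type*} (𝒰 : Ultrafilter ι) {K : Set X}
    (hK : IsCompact K) (g : ι → T → X) (hg : ∀ i t, g i t ∈ K) :
    ∃ f : T → X, ∀ t, Filter.Tendsto (fun i => g i t) 𝒰 (𝓝 (f t)) := by
  have : ∀ t, ∃ y, Filter.Tendsto (fun i => g i t) 𝒰 (𝓝 y) := fun t => by
    obtain ⟨y, -, hy⟩ := isCompact_iff_ultrafilter_le_nhds'.1 hK (𝒰.map (fun i => g i t))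
      (Filter.mem_map.2 (Filter.univ_mem' fun i => hg i t))
    exact ⟨y, hy⟩
  choose f hf using this
  exact ⟨f, hf⟩

/-- The path traced by a map of the unit interval which multiplies all distances by `K`. -/
def pathOfDistEq (f : I → X) {a b : X} (ha : f 0 = a) (hb : f 1 = b) (K : ℝ)
    (hf : ∀ s t : I, dist (f s) (f t) = K * |(s : ℝ) - t|) : Path a b where
  toFun := f
  continuous_toFun := by
    refine (LipschitzWith.of_dist_le_mul (K := K.toNNReal) fun s t => ?_).continuous
    rw [hf, Subtype.dist_eq, Real.dist_eq]
    exact mul_le_mul_of_nonneg_right (Real.le_coe_toNNReal K) (abs_nonneg _)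
  source' := ha
  target' := hb

theorem isMinimal_pathOfDistEq (f : I → X) {a b : X} (ha : f 0 = a) (hb : f 1 = b) (K : ℝ)
    (hf : ∀ s t : I, dist (f s) (f t) = K * |(s : ℝ) - t|) :
    IsMinimal (pathOfDistEq f ha hb K hf) := by
  have hK : dist a b = K := by
    have := hf 0 1
    rw [ha, hb] at this
    simpa using this
  intro s t
  rw [hK]
  exact hf s t

/-- In a proper length space any two points are joined by a minimal geodesic. For a path of length
less than `d(a, b) + ε`, choosing for each `t` a point of the path at distance `t d(a, b)` from `a`
gives a map which preserves rescaled distances up to `ε`; an ultralimit of such maps is a geodesic.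
-/
theorem IsLengthSpace.exists_isMinimal [ProperSpace X] (hX : IsLengthSpace X) (a b : X) :
    ∃ γ : Path a b, IsMinimal γ := by
  set d := dist a b with hd
  have hd0 : 0 ≤ d := dist_nonneg
  have approx : ∀ n : ℕ, ∃ g : I → X, (∀ t, dist a (g t) = d * t) ∧ g 0 = a ∧
      dist (g 1) b ≤ 1 / (n + 1 : ℝ) ∧
      ∀ s t, dist (g s) (g t) ≤ d * |(s : ℝ) - t| + 1 / (n + 1 : ℝ) := fun n => by
    have hn : (0 : ℝ) < 1 / (n + 1 : ℝ) := Nat.one_div_pos_of_nat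
    obtain ⟨γ, hγ⟩ := hX.exists_path (a := a) (b := b) (r := d + 1 / (n + 1 : ℝ)) (by linarith)
    have hivt : ∀ t : I, ∃ u : I, dist a (γ u) = d * t := fun t => by
      have := intermediate_value_univ (0 : I) 1 (f := fun u => dist a (γ u)) (by fun_prop)
      obtain ⟨u, hu⟩ := this (show d * (t : ℝ) ∈ Icc _ _ by
        simp only [Path.source, Path.target, dist_self]
        exact ⟨mul_nonneg hd0 t.2.1, mul_le_of_le_one_right hd0 t.2.2⟩)
      exact ⟨u, hu⟩
    choose u hu using hivt
    refine ⟨fun t => γ (u t), hu, ?_, ?_, ?_⟩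
    · have := hu 0
      simp only [Icc.coe_zero, mul_zero, dist_eq_zero] at this
      exact this.symm
    · have h1 := hu 1
      have h2 := hγ (u 1) (u 1) le_rfl
      simp only [Icc.coe_one, mul_one, dist_self, add_zero] at h1 h2
      linarith
    · have key : ∀ s t, u s ≤ u t →
          dist (γ (u s)) (γ (u t)) ≤ d * |(s : ℝ) - t| + 1 / (n + 1 : ℝ) := fun s t hst => by
        -- The three consecutive pieces have total length below `d + 1 / (n + 1)`; the first has
        -- length at least `d s` and the last at least `d - d t`.
        have h1 := hγ _ _ hst
        have h2 := dist_triangle a (γ (u t)) b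
        have h3 : d * (t - s : ℝ) ≤ d * |(s : ℝ) - t| :=
          mul_le_mul_of_nonneg_left (by rw [abs_sub_comm]; exact le_abs_self _) hd0
        rw [hu] at h1 h2
        nlinarith
      intro s t
      rcases le_total (u s) (u t) with h | h
      · exact key s t h
      · rw [dist_comm, abs_sub_comm]; exact key t s h
  choose g hga hg0 hg1 hgl using approx
  obtain ⟨f, hf⟩ := exists_tendsto_of_mem_compact (Filter.hyperfilter ℕ)
    (isCompact_closedBall a d) g (fun n t => by
      rw [Metric.mem_closedBall, dist_comm, hga]
      exact mul_le_of_le_one_right hd0 t.2.2)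
  have hlim : Filter.Tendsto (fun n : ℕ => 1 / (n + 1 : ℝ)) (Filter.hyperfilter ℕ) (𝓝 0) :=
    tendsto_one_div_add_atTop_nhds_zero_nat.mono_left Nat.hyperfilter_le_atTop
  have hf0 : f 0 = a := tendsto_nhds_unique (hf 0) (by simp [hg0])
  have hf1 : f 1 = b := by
    have := le_of_tendsto_of_tendsto' ((hf 1).dist tendsto_const_nhds) hlim hg1
    exact dist_le_zero.1 this
  have hfa : ∀ t, dist a (f t) = d * t := fun t =>
    tendsto_nhds_unique (tendsto_const_nhds.dist (hf t)) (by simp [hga])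
  have hfd : ∀ s t : I, dist (f s) (f t) = d * |(s : ℝ) - t| := fun s t => by
    refine le_antisymm ?_ ?_
    · simpa using le_of_tendsto_of_tendsto' ((hf s).dist (hf t)) (tendsto_const_nhds.add hlim)
        (fun n => hgl n s t)
    · have h1 := dist_triangle a (f s) (f t)
      have h2 := dist_triangle a (f t) (f s)
      rw [hfa, hfa] at h1
      rw [hfa, hfa, dist_comm (f t)] at h2
      rw [← abs_of_nonneg hd0, ← abs_mul, abs_le']
      constructor <;> linarith
  exact ⟨_, isMinimal_pathOfDistEq f hf0 hf1 d hfd⟩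

end LengthSpace

/-! ### The quotient of the fundamental groupoid by a covering group -/

section Holonomy

open CategoryTheory

variable {X : Type*} [TopologicalSpace X] {x : X}

/-- Two path classes with the same end points are identified modulo `H` when the loop formed by the
first and the inverse of the second lies in `H`, whatever path from `x` is used to transport it to
the base point. -/
def holRel (H : Subgroup (FundamentalGroup X x)) : HomRel (FundamentalGroupoid X) :=
  fun y _ a b => ∀ α : FundamentalGroupoid.mk x ⟶ y,
    End.of (α ≫ a ≫ Groupoid.inv b ≫ Groupoid.inv α) ∈ H

instance (H : Subgroup (FundamentalGroup X x)) : Congruence (holRel H) where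
  comp_left f g g' h α := by
    have := h (α ≫ f)
    simpa using this
  comp_right g h α := by
    have := h α
    simpa using this
  equivalence :=
    { refl := fun a α => by
        have := H.one_mem
        simpa using this
      symm := fun {a b} h α => by
        have := H.inv_mem (h α)
        have e : (End.of (α ≫ a ≫ Groupoid.inv b ≫ Groupoid.inv α))⁻¹ =
            Groupoid.inv (α ≫ a ≫ Groupoid.inv b ≫ Groupoid.inv α) := rfl
        rw [e] at this
        simpa using this
      trans := fun {a b c} h₁ h₂ α => by
        have := H.mul_mem (h₂ α) (h₁ α)
        rw [End.mul_def] at this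
        simpa using this }

/-- The class of a path in the quotient of the fundamental groupoid by `H`. -/
noncomputable def hol (H : Subgroup (FundamentalGroup X x)) {y z : X} (γ : Path y z) :
    (Quotient.functor (holRel H)).obj ⟨y⟩ ⟶ (Quotient.functor (holRel H)).obj ⟨z⟩ :=
  (Quotient.functor (holRel H)).map (FundamentalGroupoid.fromPath (Path.Homotopic.Quotient.mk γ))

variable {H : Subgroup (FundamentalGroup X x)} {y z w : X}

theorem hol_eq_of_homotopic {γ γ' : Path y z} (h : γ.Homotopic γ') : hol H γ = hol H γ' := by
  unfold hol
  rw [(FundamentalGroupoid.fromPath_eq_iff_homotopic γ γ').2 h]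

theorem hol_trans (γ : Path y z) (γ' : Path z w) : hol H (γ.trans γ') = hol H γ ≫ hol H γ' :=
  (Quotient.functor (holRel H)).map_comp (X := ⟨y⟩) (Y := ⟨z⟩) (Z := ⟨w⟩)
    (FundamentalGroupoid.fromPath (Path.Homotopic.Quotient.mk γ))
    (FundamentalGroupoid.fromPath (Path.Homotopic.Quotient.mk γ'))

theorem hol_refl : hol H (Path.refl y) = 𝟙 _ :=
  (Quotient.functor (holRel H)).map_id ⟨y⟩

theorem hol_trans_symm (γ : Path y z) : hol H γ ≫ hol H γ.symm = 𝟙 _ := by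
  rw [← hol_trans, ← hol_refl]
  exact hol_eq_of_homotopic ⟨(Path.Homotopy.reflTransSymm γ).symm⟩

theorem hol_symm (γ : Path y z) : hol H γ.symm = inv (hol H γ) :=
  (IsIso.inv_eq_of_hom_inv_id (hol_trans_symm γ)).symm

theorem hol_eq_id_iff {β : Path y y} : hol H β = 𝟙 _ ↔
    ∀ α : Path x y, FundamentalGroup.fromPath
      (Path.Homotopic.Quotient.mk ((α.trans β).trans α.symm)) ∈ H := by
  unfold hol
  rw [← CategoryTheory.Functor.map_id, Quotient.functor_map_eq_iff]
  have key : ∀ α : Path x y, End.of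
      (FundamentalGroupoid.fromPath (Path.Homotopic.Quotient.mk α) ≫
        FundamentalGroupoid.fromPath (Path.Homotopic.Quotient.mk β) ≫ Groupoid.inv (𝟙 _) ≫
        Groupoid.inv (FundamentalGroupoid.fromPath (Path.Homotopic.Quotient.mk α))) =
      FundamentalGroup.fromPath
        (Path.Homotopic.Quotient.mk ((α.trans β).trans α.symm)) := fun α => by
    have e : FundamentalGroup.fromPath
        (Path.Homotopic.Quotient.mk ((α.trans β).trans α.symm)) =
      (FundamentalGroupoid.fromPath (Path.Homotopic.Quotient.mk α) ≫
        FundamentalGroupoid.fromPath (Path.Homotopic.Quotient.mk β)) ≫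
        Groupoid.inv (FundamentalGroupoid.fromPath (Path.Homotopic.Quotient.mk α)) := rfl
    rw [e]
    simp
  refine ⟨fun h α => ?_, fun h α => ?_⟩
  · rw [← key]
    exact h _
  · obtain ⟨α, rfl⟩ := Path.Homotopic.Quotient.mk_surjective α
    have h' := h α
    rw [← key] at h'
    exact h'

theorem hol_subpath_trans (γ : Path y z) (r s t : I) :
    hol H (γ.subpath r s) ≫ hol H (γ.subpath s t) = hol H (γ.subpath r t) := by
  rw [← hol_trans]
  exact hol_eq_of_homotopic ⟨Path.Homotopy.subpathTransSubpath γ r s t⟩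

theorem hol_cast_eq_iff {y' z' : X} (hy : y' = y) (hz : z' = z) {γ γ' : Path y z} :
    hol H (γ.cast hy hz) = hol H (γ'.cast hy hz) ↔ hol H γ = hol H γ' := by
  subst hy hz
  rfl

theorem hol_subpath_zero_trans_subpath_one (γ : Path y z) (s : I) :
    hol H ((γ.subpath 0 s).cast γ.source.symm rfl) ≫
      hol H ((γ.subpath s 1).cast rfl γ.target.symm) = hol H γ := by
  rw [← hol_trans, ← hol_cast_eq_iff (y' := γ 0) (z' := γ 1) γ.source γ.target,
    ← Path.cast_trans, ← Path.subpath_zero_one]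
  exact hol_eq_of_homotopic ⟨Path.Homotopy.subpathTransSubpath γ 0 s 1⟩

theorem hol_subpath_symm (γ : Path y z) (s t : I) :
    hol H (γ.subpath t s) = inv (hol H (γ.subpath s t)) := by
  rw [← hol_symm, Path.symm_subpath]

theorem hol_spanierGroup_eq {𝒰 : Set (Set X)} {U : Set X} (hU : U ∈ 𝒰) {γ γ' : Path y z}
    (hγ : range γ ⊆ U) (hγ' : range γ' ⊆ U) :
    hol (spanierGroup 𝒰 x) γ = hol (spanierGroup 𝒰 x) γ' := by
  have : hol (spanierGroup 𝒰 x) (γ.trans γ'.symm) = 𝟙 _ := hol_eq_id_iff.2 fun α =>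
    Subgroup.subset_closure ⟨U, hU, y, α, γ.trans γ'.symm, by
      rw [Path.trans_range, Path.symm_range]
      exact union_subset hγ hγ', rfl⟩
  rwa [hol_trans, hol_symm, IsIso.comp_inv_eq, Category.id_comp] at this

/-- A Spanier group is contained in `H` as soon as all small loops have trivial class modulo `H`. -/
theorem spanierGroup_le {𝒰 : Set (Set X)}
    (h : ∀ U ∈ 𝒰, ∀ (y : X) (β : Path y y), range β ⊆ U → hol H β = 𝟙 _) :
    spanierGroup 𝒰 x ≤ H := by
  refine (Subgroup.closure_le _).2 ?_
  rintro _ ⟨U, hU, y, α, β, hβ, rfl⟩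
  exact hol_eq_id_iff.1 (h U hU y β hβ) α

theorem eventually_range_subpath_subset (γ : Path y z) (s : I) {U : Set X} (hU : U ∈ 𝓝 (γ s)) :
    ∀ᶠ t in 𝓝 s, range (γ.subpath s t) ⊆ U := by
  have h1 : Filter.Tendsto (fun t => uIcc s t) (𝓝 s) (𝓝 s).smallSets :=
    tendsto_const_nhds.uIcc Filter.tendsto_id
  have h2 := Filter.tendsto_smallSets_iff.1 h1 _ (γ.continuous.continuousAt hU)
  filter_upwards [h2] with t ht
  rw [Path.range_subpath]
  exact image_subset_iff.2 ht

/-- Cutting a loop into short pieces: a loop `β` whose class modulo `H` is nontrivial contains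
arbitrarily short arcs which, together with the chosen paths from `q` to their end points, form a
nontrivial triangle. -/
theorem exists_frequently_hol_triangle_ne {q : X} (G : ∀ a, Path q a) {β : Path y y}
    (hβ : hol H β ≠ 𝟙 _) :
    ∃ t, ∃ᶠ s in 𝓝 t, hol H (G (β t)) ≫ hol H (β.subpath t s) ≠ hol H (G (β s)) := by
  by_contra! hcon
  -- If all short triangles were trivial, triviality would propagate along the connected interval.
  let P : I → I → Prop := fun t s => hol H (G (β t)) ≫ hol H (β.subpath t s) = hol H (G (β s))
  have : Std.Symm P := ⟨fun t s h => by
    simp only [P] at h ⊢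
    rw [hol_subpath_symm, IsIso.comp_inv_eq, h]⟩
  have h01 : P 0 1 := PreconnectedSpace.induction₂ P hcon ⟨fun r s t h1 h2 => by
    simp only [P] at h1 h2 ⊢
    rw [← hol_subpath_trans β r s t, ← Category.assoc, h1, h2]⟩ 0 1
  simp only [P, Path.subpath_zero_one] at h01
  have transport : ∀ {u v : X} (hu : u = y) (hv : v = y),
      hol H (G u) ≫ hol H (β.cast hu hv) = hol H (G v) →
      hol H (G y) ≫ hol H β = hol H (G y) := by
    rintro u _ rfl rfl h
    exact h
  have h := transport β.source β.target h01
  refine hβ ?_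
  rwa [← IsIso.eq_inv_comp, IsIso.inv_hom_id] at h

end Holonomy

/-! ### Uniformly close paths and limits of geodesics -/

section Limits

open CategoryTheory

variable {X : Type*} [MetricSpace X] {x : X} {H : Subgroup (FundamentalGroup X x)} {δ : ℝ}

/-- Any two paths with the same end points in a common open ball of radius `δ` have the same class
modulo `H`. -/
def TrivialOnBalls (H : Subgroup (FundamentalGroup X x)) (δ : ℝ) : Prop :=
  ∀ (q y z : X) (γ γ' : Path y z), range γ ⊆ Metric.ball q δ → range γ' ⊆ Metric.ball q δ →
    hol H γ = hol H γ'

/-- Two paths which stay at distance less than `δ / 2` of each other have the same class modulo `H`,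
up to short paths joining their end points. The two paths are compared on short subintervals, where
everything takes place in a single ball. -/
theorem TrivialOnBalls.hol_trans_eq_of_dist_lt (hX : IsLengthSpace X) (hH : TrivialOnBalls H δ)
    (hδ : 0 < δ) {a b a' b' : X} {f : Path a b} {g : Path a' b'}
    (hfg : ∀ t, dist (f t) (g t) < δ / 2) {ρ : Path a a'} (hρ : range ρ ⊆ Metric.ball a (δ / 2))
    {τ : Path b b'} (hτ : range τ ⊆ Metric.ball b (δ / 2)) :
    hol H f ≫ hol H τ = hol H ρ ≫ hol H g := by
  choose κ hκ using fun t => hX.exists_path_subset_ball (hfg t)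
  let P : I → I → Prop := fun s t =>
    hol H (f.subpath s t) ≫ hol H (κ t) = hol H (κ s) ≫ hol H (g.subpath s t)
  have : Std.Symm P := ⟨fun s t h => by
    simp only [P] at h ⊢
    rw [hol_subpath_symm f, hol_subpath_symm g, IsIso.inv_comp_eq, ← Category.assoc,
      IsIso.eq_comp_inv, h]⟩
  have h01 : P 0 1 := PreconnectedSpace.induction₂ P (fun s => by
    have hf := eventually_range_subpath_subset f s
      (Metric.ball_mem_nhds (f s) (half_pos (half_pos hδ)))
    have hg := eventually_range_subpath_subset g s
      (Metric.isOpen_ball.mem_nhds (show g s ∈ Metric.ball (f s) (δ / 2) by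
        rw [Metric.mem_ball, dist_comm]; exact hfg s))
    filter_upwards [hf, hg] with t hft hgt
    simp only [P]
    rw [← hol_trans, ← hol_trans]
    refine hH (f s) _ _ _ _ ?_ ?_
    · rw [Path.trans_range]
      refine union_subset (hft.trans (Metric.ball_subset_ball (by linarith))) ?_
      refine (hκ t).trans (Metric.ball_subset_ball' ?_)
      have := hft ⟨1, (f.subpath s t).target⟩
      rw [Metric.mem_ball] at this
      linarith
    · rw [Path.trans_range]
      exact union_subset ((hκ s).trans (Metric.ball_subset_ball (by linarith)))
        (hgt.trans (Metric.ball_subset_ball (by linarith)))) ⟨fun r s t h1 h2 => by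
    simp only [P] at h1 h2 ⊢
    rw [← hol_subpath_trans f r s t, Category.assoc, h2, ← Category.assoc, h1, Category.assoc,
      hol_subpath_trans]⟩ 0 1
  simp only [P, Path.subpath_zero_one] at h01
  let κ₀ : Path a a' := (κ 0).cast f.source.symm g.source.symm
  let κ₁ : Path b b' := (κ 1).cast f.target.symm g.target.symm
  have h0 : hol H κ₀ = hol H ρ := hH a _ _ _ _
    ((show range κ₀ ⊆ Metric.ball a (δ / 2) by simpa [κ₀] using hκ 0).trans
      (Metric.ball_subset_ball (by linarith)))
    (hρ.trans (Metric.ball_subset_ball (by linarith)))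
  have h1 : hol H κ₁ = hol H τ := hH b _ _ _ _
    ((show range κ₁ ⊆ Metric.ball b (δ / 2) by simpa [κ₁] using hκ 1).trans
      (Metric.ball_subset_ball (by linarith)))
    (hτ.trans (Metric.ball_subset_ball (by linarith)))
  rw [← h0, ← h1, ← hol_trans, ← hol_trans,
    ← hol_cast_eq_iff (y' := f 0) (z' := g 1) f.source g.target,
    Path.cast_trans f κ₁ f.source f.target g.target,
    Path.cast_trans κ₀ g f.source g.source g.target, hol_trans, hol_trans]
  exact h01

/-- Minimal geodesics of bounded length in a compact set converge uniformly along an ultrafilter to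
a minimal geodesic between the limits of the end points. -/
theorem exists_isMinimal_limit {ι : Type*} (𝒰 : Ultrafilter ι) {K : Set X} (hK : IsCompact K)
    {C : ℝ} {a b : ι → X} {a₀ b₀ : X} (ha : Filter.Tendsto a 𝒰 (𝓝 a₀))
    (hb : Filter.Tendsto b 𝒰 (𝓝 b₀)) (g : ∀ i, Path (a i) (b i)) (hg : ∀ i, IsMinimal (g i))
    (hgK : ∀ i t, g i t ∈ K) (hC : ∀ i, dist (a i) (b i) ≤ C) :
    ∃ f : Path a₀ b₀, IsMinimal f ∧
      ∀ ε > 0, ∀ᶠ i in (𝒰 : Filter ι), ∀ t, dist (g i t) (f t) < ε := by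
  obtain ⟨f, hf⟩ := exists_tendsto_of_mem_compact 𝒰 hK (fun i t => g i t) hgK
  have h0 : f 0 = a₀ := tendsto_nhds_unique (hf 0) (by simpa using ha)
  have h1 : f 1 = b₀ := tendsto_nhds_unique (hf 1) (by simpa using hb)
  have hd : ∀ s t : I, dist (f s) (f t) = dist a₀ b₀ * |(s : ℝ) - t| := fun s t => by
    refine tendsto_nhds_unique ((hf s).dist (hf t)) ?_
    simp only [hg _ s t]
    exact (ha.dist hb).mul_const _
  refine ⟨pathOfDistEq f h0 h1 _ hd, isMinimal_pathOfDistEq f h0 h1 _ hd, fun ε hε => ?_⟩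
  have hlip : UniformEquicontinuous (fun i (t : I) => g i t) :=
    LipschitzWith.uniformEquicontinuous _ C.toNNReal fun i => LipschitzWith.of_dist_le_mul
      fun s t => by
        rw [hg i, Subtype.dist_eq, Real.dist_eq]
        exact mul_le_mul_of_nonneg_right ((hC i).trans (Real.le_coe_toNNReal C)) (abs_nonneg _)
  have hu := (hlip.equicontinuous.tendsto_uniformFun_iff_pi 𝒰 f).2 (tendsto_pi_nhds.2 hf)
  rw [UniformFun.tendsto_iff_tendstoUniformly] at hu
  filter_upwards [Metric.tendstoUniformly_iff.1 hu ε hε] with i hi t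
  rw [dist_comm]
  exact hi t

/-- A sequence of geodesic triangles which are nontrivial modulo `H`, whose two long sides issue
from a bounded sequence of points and have lengths converging to `δ`, and whose third side shrinks
to a point, accumulates at a nontrivial bigon: two minimal geodesics of length at most `δ` with the
same end points and with different classes modulo `H`. -/
theorem TrivialOnBalls.exists_hol_ne (hX : IsLengthSpace X) [ProperSpace X]
    (hH : TrivialOnBalls H δ) (hδ : 0 < δ) {C : ℝ}
    (h : ∀ ε > 0, ∃ (q a b : X) (g : Path q a) (g' : Path q b) (κ : Path a b),
      dist q x ≤ C ∧ dist q a ≤ δ + ε ∧ IsMinimal g ∧ IsMinimal g' ∧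
        range κ ⊆ Metric.ball a ε ∧ hol H g ≫ hol H κ ≠ hol H g') :
    ∃ (q a : X) (g g' : Path q a), dist q a ≤ δ ∧ IsMinimal g ∧ IsMinimal g' ∧
      hol H g ≠ hol H g' := by
  choose q a b g g' κ hq hqa hg hg' hκ hne using
    fun n : ℕ => h (1 / (n + 1 : ℝ)) Nat.one_div_pos_of_nat
  have hle1 : ∀ n : ℕ, 1 / (n + 1 : ℝ) ≤ 1 := fun n => by
    rw [div_le_one (by positivity)]; linarith [(Nat.cast_nonneg n : (0 : ℝ) ≤ n)]
  have hab : ∀ n, dist (b n) (a n) < 1 / (n + 1 : ℝ) := fun n => hκ n ⟨1, (κ n).target⟩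
  have hqb : ∀ n, dist (q n) (b n) ≤ δ + 2 := fun n => by
    linarith [hle1 n, hqa n, (hab n).le, dist_triangle (q n) (a n) (b n), dist_comm (a n) (b n)]
  have hqa' : ∀ n, dist (q n) (a n) ≤ δ + 2 := fun n => by linarith [hle1 n, hqa n]
  have hlim : Filter.Tendsto (fun n : ℕ => 1 / (n + 1 : ℝ)) (Filter.hyperfilter ℕ) (𝓝 0) :=
    tendsto_one_div_add_atTop_nhds_zero_nat.mono_left Nat.hyperfilter_le_atTop
  set K := Metric.closedBall x (C + (δ + 2)) with hKdef
  have hK : IsCompact K := isCompact_closedBall _ _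
  have hside : ∀ (n : ℕ) (c : X) (γ : Path (q n) c), IsMinimal γ → dist (q n) c ≤ δ + 2 →
      ∀ t, γ t ∈ K := fun n c γ hγ hc t => by
    have h1 := hγ.dist_left t
    have h2 : dist (q n) c * t ≤ dist (q n) c := mul_le_of_le_one_right dist_nonneg t.2.2
    rw [hKdef, Metric.mem_closedBall]
    linarith [dist_triangle (γ t) (q n) x, dist_comm (γ t) (q n), hq n]
  have hgK := fun n => hside n _ (g n) (hg n) (hqa' n)
  have hgK' := fun n => hside n _ (g' n) (hg' n) (hqb n)
  obtain ⟨e, he⟩ := exists_tendsto_of_mem_compact (Filter.hyperfilter ℕ) hK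
    (fun n t => g n t) hgK
  have hqlim : Filter.Tendsto q (Filter.hyperfilter ℕ) (𝓝 (e 0)) := by simpa using he 0
  have halim : Filter.Tendsto a (Filter.hyperfilter ℕ) (𝓝 (e 1)) := by simpa using he 1
  have hblim : Filter.Tendsto b (Filter.hyperfilter ℕ) (𝓝 (e 1)) :=
    (tendsto_iff_of_dist (squeeze_zero (fun n => dist_nonneg) (fun n => (hab n).le) hlim)).2 halim
  obtain ⟨f, hf, hfu⟩ := exists_isMinimal_limit _ hK hqlim halim g hg hgK hqa'
  obtain ⟨f', hf', hfu'⟩ := exists_isMinimal_limit _ hK hqlim hblim g' hg' hgK' hqb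
  refine ⟨e 0, e 1, f, f', ?_, hf, hf', fun heq => ?_⟩
  · have := le_of_tendsto_of_tendsto' (hqlim.dist halim) (tendsto_const_nhds.add hlim) hqa
    simpa using this
  have h4 : (0 : ℝ) < δ / 4 := by positivity
  obtain ⟨n, h1, h2, h3⟩ := ((hfu _ h4).and ((hfu' _ h4).and
    (hlim.eventually (gt_mem_nhds h4)))).exists
  have hq0 : dist (q n) (e 0) < δ / 4 := by simpa using h1 0
  have ha1 : dist (a n) (e 1) < δ / 4 := by simpa using h1 1
  have hb1 : dist (b n) (e 1) < δ / 4 := by simpa using h2 1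
  obtain ⟨ρ, hρ⟩ := hX.exists_path_subset_ball hq0
  obtain ⟨τ, hτ⟩ := hX.exists_path_subset_ball ha1
  obtain ⟨τ', hτ'⟩ := hX.exists_path_subset_ball hb1
  have hball : ∀ {c : X}, Metric.ball c (δ / 4) ⊆ Metric.ball c (δ / 2) := fun {c} =>
    Metric.ball_subset_ball (by linarith)
  have e1 := hH.hol_trans_eq_of_dist_lt hX hδ (fun t => (h1 t).trans (by linarith))
    (hρ.trans hball) (hτ.trans hball)
  have e2 := hH.hol_trans_eq_of_dist_lt hX hδ (fun t => (h2 t).trans (by linarith))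
    (hρ.trans hball) (hτ'.trans hball)
  have e3 : hol H (κ n) ≫ hol H τ' = hol H τ := by
    rw [← hol_trans]
    refine hH (a n) _ _ _ _ ?_ (hτ.trans (Metric.ball_subset_ball (by linarith)))
    rw [Path.trans_range]
    refine union_subset ((hκ n).trans (Metric.ball_subset_ball (by linarith)))
      (hτ'.trans (Metric.ball_subset_ball' ?_))
    linarith [hab n]
  refine hne n ?_
  rw [← cancel_mono (hol H τ'), Category.assoc, e3, e1, e2, heq]

end Limits

/-! ### Closed geodesics from nontrivial bigons -/

section Bigon

open CategoryTheory

variable {X : Type*} [MetricSpace X]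

/-- A nontrivial bigon of minimal geodesics of length at most `δ` has sides of length exactly `δ`,
and any chord from one side to the other is at least as long as the shorter of the two arcs of the
bigon that it cuts off: a shorter chord would cut the bigon into two loops of length less than
`2 δ`, each of which is contained in a ball of radius `δ` about one of the vertices. -/
theorem TrivialOnBalls.dist_bigon (hX : IsLengthSpace X) {x : X}
    {H : Subgroup (FundamentalGroup X x)} {δ : ℝ} (hH : TrivialOnBalls H δ)
    {q a : X} {g g' : Path q a} (hqa : dist q a ≤ δ) (hg : IsMinimal g) (hg' : IsMinimal g')
    (hne : hol H g ≠ hol H g') :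
    dist q a = δ ∧
      ∀ s t : I, dist (g s) (g' t) = min (δ * (s + t)) (2 * δ - δ * (s + t)) := by
  have hd : dist q a = δ := by
    by_contra hlt
    have hlt : dist q a < δ := lt_of_le_of_ne hqa hlt
    have hball : ∀ γ : Path q a, IsMinimal γ → range γ ⊆ Metric.ball q δ := by
      rintro γ hγ _ ⟨t, rfl⟩
      rw [Metric.mem_ball, dist_comm, hγ.dist_left]
      exact (mul_le_of_le_one_right dist_nonneg t.2.2).trans_lt hlt
    exact hne (hH q _ _ _ _ (hball g hg) (hball g' hg'))
  have hδ : 0 ≤ δ := hd ▸ dist_nonneg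
  refine ⟨hd, fun s t => ?_⟩
  have hgl := fun t => hd ▸ hg.dist_left t
  have hgl' := fun t => hd ▸ hg'.dist_left t
  have hgr := fun t => hd ▸ hg.dist_right t
  have hgr' := fun t => hd ▸ hg'.dist_right t
  refine le_antisymm (le_min ?_ ?_) ?_
  · have := dist_triangle_left (g s) (g' t) q
    rw [hgl, hgl'] at this
    linarith
  · have := dist_triangle_right (g s) (g' t) a
    rw [hgr, hgr'] at this
    linarith
  by_contra! hlt
  obtain ⟨h1, h2⟩ := lt_min_iff.1 hlt
  have hδ0 : 0 < δ := by
    refine lt_of_le_of_ne hδ fun h0 => ?_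
    rw [← h0, zero_mul] at h1
    exact absurd h1 (not_lt.2 dist_nonneg)
  -- The four degenerate positions of the chord, where one of its ends is a vertex.
  have hs0 : (0 : ℝ) < s := lt_of_le_of_ne s.2.1 fun h0 => by
    have : s = 0 := Subtype.ext h0.symm
    subst this
    rw [g.source, hgl'] at h1
    simp at h1
  have ht0 : (0 : ℝ) < t := lt_of_le_of_ne t.2.1 fun h0 => by
    have : t = 0 := Subtype.ext h0.symm
    subst this
    rw [g'.source, dist_comm, hgl] at h1
    simp at h1
  have hs1 : (s : ℝ) < 1 := lt_of_le_of_ne s.2.2 fun h0 => by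
    have : s = 1 := Subtype.ext h0
    subst this
    rw [g.target, dist_comm, hgr', Icc.coe_one] at h2
    linarith
  have ht1 : (t : ℝ) < 1 := lt_of_le_of_ne t.2.2 fun h0 => by
    have : t = 1 := Subtype.ext h0
    subst this
    rw [g'.target, hgr, Icc.coe_one] at h2
    linarith
  obtain ⟨κ, hκ⟩ := hX.exists_path_add_lt hlt
  have near_q : hol H ((g.subpath 0 s).cast g.source.symm rfl) ≫ hol H κ =
      hol H ((g'.subpath 0 t).cast g'.source.symm rfl) := by
    rw [← hol_trans]
    refine hH q _ _ _ _ ?_ ?_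
    · rw [Path.trans_range, Path.cast_coe, Path.range_subpath_of_le _ _ _ s.2.1]
      refine union_subset ?_ ?_
      · rintro _ ⟨u, hu, rfl⟩
        have : (u : ℝ) ≤ s := hu.2
        rw [Metric.mem_ball, dist_comm, hgl]
        nlinarith
      · rintro _ ⟨u, rfl⟩
        have h3 := (lt_min_iff.1 (hκ u)).2
        have h4 := dist_triangle q (g s) (κ u)
        have h5 := dist_triangle_right q (κ u) (g' t)
        rw [hgl] at h4
        rw [hgl'] at h5
        rw [Metric.mem_ball, dist_comm]
        linarith
    · rw [Path.cast_coe, Path.range_subpath_of_le _ _ _ t.2.1]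
      rintro _ ⟨u, hu, rfl⟩
      have : (u : ℝ) ≤ t := hu.2
      rw [Metric.mem_ball, dist_comm, hgl']
      nlinarith
  have near_a : hol H κ ≫ hol H ((g'.subpath t 1).cast rfl g'.target.symm) =
      hol H ((g.subpath s 1).cast rfl g.target.symm) := by
    rw [← hol_trans]
    refine hH a _ _ _ _ ?_ ?_
    · rw [Path.trans_range, Path.cast_coe, Path.range_subpath_of_le _ _ _ t.2.2]
      refine union_subset ?_ ?_
      · rintro _ ⟨u, rfl⟩
        have h3 := (lt_min_iff.1 (hκ u)).1
        have h4 := dist_triangle_left (κ u) a (g s)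
        have h5 := dist_triangle (κ u) (g' t) a
        rw [hgr] at h4
        rw [hgr'] at h5
        rw [Metric.mem_ball]
        linarith
      · rintro _ ⟨u, hu, rfl⟩
        have : (t : ℝ) ≤ u := hu.1
        rw [Metric.mem_ball, hgr']
        nlinarith
    · rw [Path.cast_coe, Path.range_subpath_of_le _ _ _ s.2.2]
      rintro _ ⟨u, hu, rfl⟩
      have : (s : ℝ) ≤ u := hu.1
      rw [Metric.mem_ball, hgr]
      nlinarith
  refine hne ?_
  rw [← hol_subpath_zero_trans_subpath_one g s, ← hol_subpath_zero_trans_subpath_one g' t,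
    ← near_q, ← near_a, Category.assoc]

theorem norm_coe_addCircle_eq_min {δ w : ℝ} (h0 : 0 ≤ w) (h1 : w ≤ 2 * δ) :
    ‖(w : AddCircle (2 * δ))‖ = min w (2 * δ - w) := by
  rcases eq_or_lt_of_le (h0.trans h1) with h | hδ
  · have hw : w = 0 := by linarith
    subst hw
    simp [← h]
  have key : ∀ v : ℝ, |v| ≤ δ → ‖(v : AddCircle (2 * δ))‖ = |v| := fun v hv => by
    rw [AddCircle.norm_coe_eq_abs_iff _ hδ.ne', abs_of_pos hδ]
    linarith
  rcases le_total w δ with h | h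
  · rw [key w (by rwa [abs_of_nonneg h0]), abs_of_nonneg h0, min_eq_left (by linarith)]
  · have : (w : AddCircle (2 * δ)) = ((w - 2 * δ : ℝ) : AddCircle (2 * δ)) := by
      rw [AddCircle.coe_sub, AddCircle.coe_period, sub_zero]
    rw [this, key _ (by rw [abs_of_nonpos] <;> linarith), abs_of_nonpos (by linarith),
      min_eq_right (by linarith)]
    ring

/-- The two sides of a bigon fit together to a distance-preserving map from a circle. -/
theorem exists_addCircle_isometry {δ : ℝ} (hδ : 0 < δ) {q a : X} {g g' : Path q a}
    (hqa : dist q a = δ) (hg : IsMinimal g) (hg' : IsMinimal g')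
    (hd : ∀ s t : I, dist (g s) (g' t) = min (δ * (s + t)) (2 * δ - δ * (s + t))) :
    ∃ c : AddCircle (2 * δ) → X, Isometry c := by
  have : Fact (0 < 2 * δ) := ⟨by positivity⟩
  -- The circle is cut open at the vertex `a`, so that `0` corresponds to the vertex `q`.
  let F : ℝ → X := fun u =>
    if 0 ≤ u then g (projIcc 0 1 zero_le_one (u / δ)) else g' (projIcc 0 1 zero_le_one (-u / δ))
  have hF : ∀ u v : ℝ, u ≤ v → u ∈ Ico (-δ) (-δ + 2 * δ) → v ∈ Ico (-δ) (-δ + 2 * δ) →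
      dist (F u) (F v) = min (v - u) (2 * δ - (v - u)) := fun u v huv hu hv => by
    have hproj : ∀ w : ℝ, 0 ≤ w → w ≤ δ →
        δ * (projIcc (0 : ℝ) 1 zero_le_one (w / δ) : ℝ) = w := fun w h0 h1 => by
      rw [projIcc_of_mem zero_le_one ⟨by positivity, by rwa [div_le_one hδ]⟩]
      field_simp
    have hside : ∀ γ : Path q a, IsMinimal γ → ∀ w w' : ℝ, 0 ≤ w → w ≤ δ → 0 ≤ w' → w' ≤ δ →
        dist (γ (projIcc 0 1 zero_le_one (w / δ))) (γ (projIcc 0 1 zero_le_one (w' / δ))) =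
          |w - w'| := fun γ hγ w w' h0 h1 h0' h1' => by
      rw [hγ, hqa, ← abs_of_pos hδ, ← abs_mul, mul_sub, abs_of_pos hδ, hproj w h0 h1,
        hproj w' h0' h1']
    obtain ⟨hu1, hu2⟩ := hu
    obtain ⟨hv1, hv2⟩ := hv
    by_cases hu0 : 0 ≤ u
    · have hv0 := hu0.trans huv
      simp only [F, if_pos hu0, if_pos hv0]
      rw [hside g hg u v hu0 (by linarith) hv0 (by linarith), abs_of_nonpos (by linarith),
        min_eq_left (by linarith)]
      ring
    · by_cases hv0 : 0 ≤ v
      · simp only [F, if_neg hu0, if_pos hv0]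
        rw [dist_comm, hd, mul_add, hproj v hv0 (by linarith),
          hproj (-u) (by linarith) (by linarith), ← sub_eq_add_neg]
      · simp only [F, if_neg hu0, if_neg hv0]
        rw [hside g' hg' (-u) (-v) (by linarith) (by linarith) (by linarith) (by linarith),
          abs_of_nonneg (by linarith), min_eq_left (by linarith)]
        ring
  refine ⟨AddCircle.liftIco (2 * δ) (-δ) F, Isometry.of_dist_eq fun s t => ?_⟩
  have hrep : ∀ s : AddCircle (2 * δ), ∃ u ∈ Ico (-δ) (-δ + 2 * δ), (u : AddCircle (2 * δ)) = s :=
    fun s => by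
      have := AddCircle.coe_image_Ico_eq (2 * δ) (-δ) ▸ mem_univ s
      exact this
  have hc : ∀ u v : ℝ, u ≤ v → u ∈ Ico (-δ) (-δ + 2 * δ) → v ∈ Ico (-δ) (-δ + 2 * δ) →
      dist (AddCircle.liftIco (2 * δ) (-δ) F u) (AddCircle.liftIco (2 * δ) (-δ) F v) =
        dist (u : AddCircle (2 * δ)) v := fun u v huv hu hv => by
    rw [AddCircle.liftIco_coe_apply hu, AddCircle.liftIco_coe_apply hv, hF u v huv hu hv,
      dist_comm, dist_eq_norm, ← AddCircle.coe_sub,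
      norm_coe_addCircle_eq_min (by linarith) (by linarith [hu.1, hv.2])]
  obtain ⟨u, hu, rfl⟩ := hrep s
  obtain ⟨v, hv, rfl⟩ := hrep t
  rcases le_total u v with h | h
  · exact hc u v h hu hv
  · rw [dist_comm, hc v u h hv hu, dist_comm]

/-- A distance-preserving closed curve on a circle has the length of the circle: it is
`1`-Lipschitz, and the image of each half of the circle joins two points at half that distance. -/
theorem closedCurveLength_of_isometry {δ : ℝ} (hδ : 0 < δ) {c : AddCircle (2 * δ) → X}
    (hc : Isometry c) : closedCurveLength c = ENNReal.ofReal (2 * δ) := by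
  unfold closedCurveLength
  refine le_antisymm ?_ ?_
  · have hlip : LipschitzWith 1 (fun t : ℝ => c (t : AddCircle (2 * δ))) :=
      LipschitzWith.of_dist_le_mul fun s t => by
        rw [hc.dist_eq, dist_eq_norm, ← AddCircle.coe_sub, NNReal.coe_one, one_mul, Real.dist_eq,
          ← Real.norm_eq_abs]
        exact QuotientAddGroup.norm_mk_le_norm
    have := (hlip.lipschitzOnWith (s := univ)).comp_eVariationOn_le (g := id) (s := Icc 0 (2 * δ))
      (mapsTo_univ _ _)
    rw [eVariationOn_id_Icc] at this
    simpa using this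
  · have h := eVariationOn.Icc_add_Icc (fun t : ℝ => c (t : AddCircle (2 * δ))) (s := univ)
      (a := 0) (b := δ) (c := 2 * δ) hδ.le (by linarith) (mem_univ _)
    simp only [univ_inter] at h
    have key : ∀ u v : ℝ, v - u = δ → ENNReal.ofReal δ ≤
        eVariationOn (fun t : ℝ => c (t : AddCircle (2 * δ))) (Icc u v) := fun u v huv => by
      refine le_trans (le_of_eq ?_) (eVariationOn.edist_le (x := v) (y := u) _
        (right_mem_Icc.2 (by linarith)) (left_mem_Icc.2 (by linarith)))
      rw [hc.edist_eq, edist_dist, dist_eq_norm, ← AddCircle.coe_sub, huv,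
        norm_coe_addCircle_eq_min hδ.le (by linarith), min_eq_left (by linarith)]
    calc ENNReal.ofReal (2 * δ) = ENNReal.ofReal δ + ENNReal.ofReal δ := by
          rw [two_mul, ENNReal.ofReal_add hδ.le hδ.le]
      _ ≤ _ := add_le_add (key 0 δ (by ring)) (key δ (2 * δ) (by ring))
      _ = _ := h

end Bigon

/-! ### The cut-off covering spectrum -/

section CovSpec

open CategoryTheory

variable {X : Type*} [MetricSpace X]

theorem trivialOnBalls_cutoffGroup (x : X) (R δ : ℝ) : TrivialOnBalls (cutoffGroup x R δ) δ :=
  fun q _ _ _ _ h h' => hol_spanierGroup_eq (Or.inl ⟨q, rfl⟩) h h'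

theorem cutoffGroup_mono (x : X) (R : ℝ) {δ δ₁ : ℝ} (h : δ ≤ δ₁) :
    cutoffGroup x R δ ≤ cutoffGroup x R δ₁ := by
  refine spanierGroup_le fun U hU y β hβ => ?_
  rw [← hol_refl]
  rcases hU with ⟨q, rfl⟩ | hU
  · refine trivialOnBalls_cutoffGroup x R δ₁ q _ _ _ _
      (hβ.trans (Metric.ball_subset_ball h)) ?_
    have := hβ ⟨0, β.source⟩
    simpa using this.trans_le h
  · refine hol_spanierGroup_eq (Or.inr hU) hβ ?_
    have := hβ ⟨0, β.source⟩
    simpa using this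

/-- For `δ` in the cut-off covering spectrum and every `δ₁ > δ` there is a loop in a ball of radius
`δ₁` which is nontrivial in the cut-off `δ` cover. The ball meets the closed ball of radius `R` about
the base point, as loops in the complement of the latter are trivial. -/
theorem exists_loop_of_mem_cutoffCovSpec {x : X} {R δ δ₁ : ℝ} (hδ : δ ∈ cutoffCovSpec x R)
    (h : δ < δ₁) : ∃ (q y : X) (β : Path y y), dist q x ≤ R + δ₁ ∧ range β ⊆ Metric.ball q δ₁ ∧
      hol (cutoffGroup x R δ) β ≠ 𝟙 _ := by
  by_contra! hcon
  refine hδ.2 δ₁ h ?_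
  have : cutoffGroup x R δ₁ = cutoffGroup x R δ := by
    refine le_antisymm (spanierGroup_le fun U hU y β hβ => ?_) (cutoffGroup_mono x R h.le)
    have hout : range β ⊆ (Metric.closedBall x R)ᶜ → hol (cutoffGroup x R δ) β = 𝟙 _ :=
      fun hβ => by
        rw [← hol_refl]
        refine hol_spanierGroup_eq (Or.inr rfl) hβ ?_
        have := hβ ⟨0, β.source⟩
        simpa using this
    rcases hU with ⟨q, rfl⟩ | rfl
    · rcases le_or_gt (dist q x) (R + δ₁) with hq | hq
      · exact hcon q y β hq hβ
      · refine hout fun z hz => ?_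
        have hz' := hβ hz
        rw [Metric.mem_ball] at hz'
        rw [mem_compl_iff, Metric.mem_closedBall, not_le]
        linarith [dist_triangle_left q x z]
    · exact hout hβ
  rw [this]
  exact ⟨Homeomorph.refl _, fun _ => rfl⟩

/-- For `δ` in the cut-off covering spectrum there are thin geodesic triangles with two sides of
length less than `δ + ε` and the third side of length less than `ε`, at bounded distance from the
base point, which are nontrivial in the cut-off `δ` cover. -/
theorem exists_triangle_of_mem_cutoffCovSpec [ProperSpace X] (hX : IsLengthSpace X) {x : X}
    {R δ ε : ℝ} (hδ : δ ∈ cutoffCovSpec x R) (hε : 0 < ε) :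
    ∃ (q a b : X) (g : Path q a) (g' : Path q b) (κ : Path a b),
      dist q x ≤ R + (δ + 1) ∧ dist q a ≤ δ + ε ∧ IsMinimal g ∧ IsMinimal g' ∧
        range κ ⊆ Metric.ball a ε ∧
        hol (cutoffGroup x R δ) g ≫ hol (cutoffGroup x R δ) κ ≠ hol (cutoffGroup x R δ) g' := by
  obtain ⟨q, y, β, hq, hβ, hne⟩ := exists_loop_of_mem_cutoffCovSpec hδ
    (show δ < δ + min ε 1 by linarith [lt_min hε one_pos])
  choose G hG using hX.exists_isMinimal q
  obtain ⟨t, ht⟩ := exists_frequently_hol_triangle_ne G hne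
  obtain ⟨s, hs, hs'⟩ := (ht.and_eventually
    (eventually_range_subpath_subset β t (Metric.ball_mem_nhds _ hε))).exists
  refine ⟨q, β t, β s, G _, G _, β.subpath t s, by linarith [min_le_right ε 1], ?_, hG _, hG _,
    hs', hs⟩
  have := hβ ⟨t, rfl⟩
  rw [Metric.mem_ball, dist_comm] at this
  linarith [min_le_left ε 1]

end CovSpec

end CutoffSpectrum

theorem mainTheorem3 {X : Type*} [MetricSpace X] [CompleteSpace X] [LocallyCompactSpace X]
    (hX : CutoffSpectrum.IsLengthSpace X) (x : X) (R : ℝ) (δ : ℝ)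
    (hδ : δ ∈ CutoffSpectrum.cutoffCovSpec x R) :
    2 * δ ∈ CutoffSpectrum.lengthSpectrum X := by
  have := hX.properSpace
  have hδ0 : 0 < δ := hδ.1
  have hH := CutoffSpectrum.trivialOnBalls_cutoffGroup x R δ
  obtain ⟨q, a, g, g', hqa, hg, hg', hne⟩ := hH.exists_hol_ne hX hδ0
    fun ε hε => CutoffSpectrum.exists_triangle_of_mem_cutoffCovSpec hX hδ hε
  obtain ⟨hd, hdist⟩ := hH.dist_bigon hX hqa hg hg' hne
  obtain ⟨c, hc⟩ := CutoffSpectrum.exists_addCircle_isometry hδ0 hd hg hg' hdist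
  exact ⟨2 * δ, by positivity, c, fun t => ⟨Set.univ, Filter.univ_mem, fun s _ s' _ =>
    hc.dist_eq s s'⟩, CutoffSpectrum.closedCurveLength_of_isometry hδ0 hc⟩
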